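/- Let $(V,\mu)$ be an infinite, connected, locally finite weighted graph: $V$ is the vertex set, $\mu_{xy}=\mu_{yx}\ge 0$ are the edge weights, $x\sim y$ if and only if $\mu_{xy}>0$ (loops are allowed), and $\mu(x)=\sum_{y\sim x}\mu_{xy}$. For the graph distance $d$ put $B(o,r)=\{x\in V: d(o,x)\le r\}$ and $V(o,r)=\sum_{x\in B(o,r)}\mu(x)$. Let $P_n(x,y)$ be the $n$-step transition probabilities of the random walk with $P(x,y)=\mu_{xy}/\mu(x)$, let $p_n(x,y)=P_n(x,y)/\mu(y)$, let $g(x,y)=\sum_{n=0}^\infty p_n(x,y)\in[0,\infty]$ be the Green function, and for $f\ge 0$ let $Gf(x)=\sum_{y\in V} g(x,y)f(y)\mu(y)\in[0,\infty]$ (with $\infty\cdot 0=0$). For $1<p<\infty$ and $q=p/(p-1)$, the $L^p$-capacity of a finite set $K\subset V$ is $$C_p(K)=\sup\Big\{\Big(\sum_{x\in K}f(x)\mu(x)\Big)^p : f:V\to[0,\infty),\ f=0 \text{ outside } K,\ \Big(\sum_{x\in V}Gf(x)^q\mu(x)\Big)^{1/q}\le 1\Big\},$$ and $(V,\mu)$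 is called $L^p$-parabolic if $C_p(K)=0$ for every finite $K\subset V$. **Theorem.** Let $1<p\le 2$. Assume that there is a constant $b>0$ with $\mu(x)\ge b$ for all $x\in V$, and that there are $o\in V$ and constants $C>0$, $r_0>1$ such that $$V(o,r)\le C\,\frac{r^{2p}}{\log r}\qquad\text{for all } r\ge r_0 .$$ Then $(V,\mu)$ is $L^p$-parabolic. -/

import Mathlib

open Filter
open scoped ENNReal NNReal

noncomputable section

/-- A locally finite weighted graph on the vertex set `V`, given by its symmetric edge weight
`weight x y = μ_{xy} ∈ [0, ∞)`. Two vertices `x, y` are joined by an edge exactly when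
`μ_{xy} > 0`; loops (`μ_{xx} > 0`) are allowed. -/
structure WeightedGraph (V : Type*) where
  weight : V → V → ℝ≥0
  weight_symm : ∀ x y, weight x y = weight y x
  locallyFinite : ∀ x, {y | 0 < weight x y}.Finite

namespace WeightedGraph

variable {V : Type*} (Γ : WeightedGraph V)

/-- The finite set of all `y ∼ x`, that is, of all `y` with `μ_{xy} > 0`
(it contains `x` itself if there is a loop at `x`). -/
def neighbors (x : V) : Finset V := (Γ.locallyFinite x).toFinset

/-- The vertex weight `μ(x) = ∑_{y ∼ x} μ_{xy}`. -/
def vertexWeight (x : V) : ℝ≥0 := ∑ y ∈ Γ.neighbors x, Γ.weight x y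

/-- The underlying graph without its loops. Loops influence neither connectedness nor the
graph distance. -/
def toSimpleGraph : SimpleGraph V where
  Adj x y := x ≠ y ∧ 0 < Γ.weight x y
  symm := ⟨fun x y h => ⟨h.1.symm, Γ.weight_symm x y ▸ h.2⟩⟩
  loopless := ⟨fun _ h => h.1 rfl⟩

/-- Connectedness of the graph. -/
def Connected : Prop := Γ.toSimpleGraph.Connected

/-- The closed ball `B(o, r) = {x | d(o, x) ≤ r}` for the graph distance `d`
of a connected graph. -/
def ball (o : V) (r : ℝ) : Set V := {x | (Γ.toSimpleGraph.dist o x : ℝ) ≤ r}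

/-- The volume `V(o, r) = μ(B(o, r)) = ∑_{x ∈ B(o, r)} μ(x)`. -/
def volume (o : V) (r : ℝ) : ℝ≥0∞ := ∑' x : Γ.ball o r, (Γ.vertexWeight x : ℝ≥0∞)

/-- The one-step transition probability `P(x, y) = μ_{xy} / μ(x)` of the random walk
(it vanishes unless `x ∼ y`). -/
def transition (x y : V) : ℝ≥0 := Γ.weight x y / Γ.vertexWeight x

open Classical in
/-- The `n`-step transition function `P_n(x, y)` of the random walk, the probability that the walk
started at `x` is at `y` at time `n`: `P_0(x, y) = δ_x(y)` and
`P_{n+1}(x, y) = ∑_{z ∼ x} P(x, z) P_n(z, y)`. -/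
def stepTransition : ℕ → V → V → ℝ≥0
  | 0, x, y => if x = y then 1 else 0
  | n + 1, x, y => ∑ z ∈ Γ.neighbors x, Γ.transition x z * stepTransition n z y

/-- The heat kernel `p_n(x, y) = P_n(x, y) / μ(y)`. -/
def heatKernel (n : ℕ) (x y : V) : ℝ≥0 := Γ.stepTransition n x y / Γ.vertexWeight y

/-- The Green function `g(x, y) = ∑_{n ≥ 0} p_n(x, y) ∈ [0, ∞]`. -/
def green (x y : V) : ℝ≥0∞ := ∑' n : ℕ, (Γ.heatKernel n x y : ℝ≥0∞)

/-- The Green operator `G f(x) = ∑_y g(x, y) f(y) μ(y) ∈ [0, ∞]` on functions `f ≥ 0`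
(with `∞ · 0 = 0`). -/
def greenOp (f : V → ℝ≥0) (x : V) : ℝ≥0∞ :=
  ∑' y, Γ.green x y * (f y : ℝ≥0∞) * (Γ.vertexWeight y : ℝ≥0∞)

/-- The norm `‖u‖_{L^q(V)} = (∑_x u(x)^q μ(x))^{1/q} ∈ [0, ∞]` of `u : V → [0, ∞]`,
for `0 < q < ∞`. -/
def lqNorm (q : ℝ) (u : V → ℝ≥0∞) : ℝ≥0∞ :=
  (∑' x, u x ^ q * (Γ.vertexWeight x : ℝ≥0∞)) ^ (1 / q)

/-- The `L^p`-capacity, for `1 < p < ∞` and `q = p / (p - 1)`, of a finite set `K` of vertices: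
`C_p(K) = sup {ν(K)^p : ν = f μ, 0 ≤ f, f = 0 outside K, ‖G f‖_{L^q(V)} ≤ 1}`. -/
def lpCapacity (p : ℝ) (K : Finset V) : ℝ≥0∞ :=
  sSup {c : ℝ≥0∞ | ∃ f : V → ℝ≥0, (∀ x, x ∉ K → f x = 0) ∧
    Γ.lqNorm (p / (p - 1)) (Γ.greenOp f) ≤ 1 ∧
    c = ((∑ x ∈ K, f x * Γ.vertexWeight x : ℝ≥0) : ℝ≥0∞) ^ p}

/-- The weighted graph is `L^p`-parabolic (`1 < p < ∞`) if every finite set of vertices has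
`L^p`-capacity zero. -/
def IsLpParabolic (p : ℝ) : Prop := ∀ K : Finset V, Γ.lpCapacity p K = 0

end WeightedGraph

end

noncomputable section

namespace WeightedGraph

variable {V : Type*} (Γ : WeightedGraph V)

/-! If `f z > 0`, then `G f` dominates `f z` times the occupation function `∑ k, P_k(·, z)`, so it
suffices that this function has infinite `L^q`-norm for every `z` (`tsum_occupation_rpow_eq_top`);
then no nonzero `f` is admissible.

For `n ≤ k < 2n`, invariance of `μ` gives `P_k(·, z)` total mass `μ(z)`, and a Carne–Varopoulos
estimate keeps at least half of it in the ball of radius `√(A n log n)` about `z`. The block of `n`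
times thus puts mass of order `n` on a set of volume `O(n^p (log n)^(p-1))`, and Hölder makes its
`L^q`-norm to the `q` at least `c / log n` (`exists_le_sum_occupation_rpow`). With `n = 2^j` this is
a multiple of `1 / j`; superadditivity of `t ↦ t^q` adds the blocks (`sum_dyadic_rpow_le`), and the
harmonic series diverges.

The off-ball estimate writes `P^k δ_z` as an average of waves `T_m(P) δ_z`, each supported within
distance `m` of `z`. An energy identity bounds the waves without spectral theory (`wave_sq_sum_le`),
and `iterate_markov_wave_tail_le` bounds the average. -/

/-! ### The Markov operator and finite propagation speed of the discrete wave equation. -/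

/-- The Markov operator `P f(x) = ∑_{y ∼ x} P(x, y) f(y)` on real functions. -/
def markov (f : V → ℝ) (x : V) : ℝ := ∑ y ∈ Γ.neighbors x, (Γ.transition x y : ℝ) * f y

open Classical in
/-- The solution of the discrete wave equation `u_{n+2} + u_n = 2 P u_{n+1}` with initial values
`u_0 = δ_z`, `u_1 = P δ_z`; that is, `u_n = T_n(P) δ_z` for the Chebyshev polynomials `T_n`. -/
def wave (z : V) : ℕ → V → ℝ
  | 0 => Pi.single z 1
  | 1 => Γ.markov (Pi.single z 1)
  | n + 2 => fun x => 2 * Γ.markov (wave z (n + 1)) x - wave z n x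

lemma mem_neighbors {x y : V} : y ∈ Γ.neighbors x ↔ 0 < Γ.weight x y := by
  simp [neighbors]

lemma sum_weight_le_vertexWeight (S : Finset V) (x : V) :
    ∑ y ∈ S, (Γ.weight x y : ℝ) ≤ Γ.vertexWeight x := by
  classical
  unfold vertexWeight
  push_cast
  calc ∑ y ∈ S, (Γ.weight x y : ℝ) = ∑ y ∈ S with y ∈ Γ.neighbors x, (Γ.weight x y : ℝ) := by
        rw [Finset.sum_filter_of_ne]
        intro y _ hy
        rw [mem_neighbors]
        exact pos_iff_ne_zero.2 fun h => hy (by simp [h])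
    _ ≤ _ := Finset.sum_le_sum_of_subset_of_nonneg
        (fun y hy => (Finset.mem_filter.1 hy).2) (fun _ _ _ => NNReal.coe_nonneg _)

lemma sum_weight_eq_vertexWeight {S : Finset V} {x : V} (h : Γ.neighbors x ⊆ S) :
    ∑ y ∈ S, (Γ.weight x y : ℝ) = Γ.vertexWeight x := by
  unfold vertexWeight
  push_cast
  refine (Finset.sum_subset h fun y _ hy => ?_).symm
  rw [mem_neighbors] at hy
  simpa using hy

lemma vertexWeight_mul_markov {x : V} (hx : 0 < Γ.vertexWeight x) {S : Finset V} {f : V → ℝ}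
    (hf : ∀ y ∉ S, f y = 0) :
    (Γ.vertexWeight x : ℝ) * Γ.markov f x = ∑ y ∈ S, (Γ.weight x y : ℝ) * f y := by
  classical
  have hx' : (Γ.vertexWeight x : ℝ) ≠ 0 := by exact_mod_cast hx.ne'
  have h1 : (Γ.vertexWeight x : ℝ) * Γ.markov f x
      = ∑ y ∈ Γ.neighbors x, (Γ.weight x y : ℝ) * f y := by
    unfold markov transition
    rw [Finset.mul_sum]
    refine Finset.sum_congr rfl fun y _ => ?_
    push_cast
    field_simp
  rw [h1]
  trans ∑ y ∈ Γ.neighbors x ∪ S, (Γ.weight x y : ℝ) * f y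
  · refine Finset.sum_subset Finset.subset_union_left fun y _ hy => ?_
    rw [mem_neighbors] at hy
    have : Γ.weight x y = 0 := by simpa using hy
    simp [this]
  · refine (Finset.sum_subset Finset.subset_union_right fun y _ hy => ?_).symm
    simp [hf y hy]

lemma markov_sum_mul (hμ : ∀ x, 0 < Γ.vertexWeight x) {S : Finset V} {f : V → ℝ}
    (hf : ∀ y ∉ S, f y = 0) (g : V → ℝ) :
    ∑ x ∈ S, (Γ.vertexWeight x : ℝ) * (Γ.markov f x * g x)
      = ∑ x ∈ S, ∑ y ∈ S, (Γ.weight x y : ℝ) * (f y * g x) := by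
  refine Finset.sum_congr rfl fun x _ => ?_
  rw [← mul_assoc, Γ.vertexWeight_mul_markov (hμ x) hf, Finset.sum_mul]
  exact Finset.sum_congr rfl fun y _ => by ring

lemma markov_symm (hμ : ∀ x, 0 < Γ.vertexWeight x) {S : Finset V} {f g : V → ℝ}
    (hf : ∀ y ∉ S, f y = 0) (hg : ∀ y ∉ S, g y = 0) :
    ∑ x ∈ S, (Γ.vertexWeight x : ℝ) * (Γ.markov f x * g x)
      = ∑ x ∈ S, (Γ.vertexWeight x : ℝ) * (Γ.markov g x * f x) := by
  rw [Γ.markov_sum_mul hμ hf, Γ.markov_sum_mul hμ hg, Finset.sum_comm]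
  refine Finset.sum_congr rfl fun x _ => Finset.sum_congr rfl fun y _ => ?_
  rw [Γ.weight_symm]
  ring

/-- Young's inequality `f y * g x ≤ (f y ^ 2 + g x ^ 2) / 2` with `g = P f`, together with row sums
of the weights at most `μ`; the half in `g` is then absorbed on the left. -/
lemma markov_contraction (hμ : ∀ x, 0 < Γ.vertexWeight x) {S : Finset V} {f : V → ℝ}
    (hf : ∀ y ∉ S, f y = 0) :
    ∑ x ∈ S, (Γ.vertexWeight x : ℝ) * Γ.markov f x ^ 2
      ≤ ∑ x ∈ S, (Γ.vertexWeight x : ℝ) * f x ^ 2 := by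
  have h1 := Γ.markov_sum_mul hμ hf (Γ.markov f)
  set g := Γ.markov f
  have h2 : ∑ x ∈ S, ∑ y ∈ S, (Γ.weight x y : ℝ) * (f y * g x)
      ≤ ∑ x ∈ S, ∑ y ∈ S, (Γ.weight x y : ℝ) * (f y ^ 2 / 2)
        + ∑ x ∈ S, ∑ y ∈ S, (Γ.weight x y : ℝ) * (g x ^ 2 / 2) := by
    simp_rw [← Finset.sum_add_distrib, ← mul_add]
    gcongr with x _ y _
    nlinarith [sq_nonneg (f y - g x)]
  have h3 (h : V → ℝ) : ∑ x ∈ S, ∑ y ∈ S, (Γ.weight x y : ℝ) * (h x ^ 2 / 2)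
      ≤ (∑ x ∈ S, (Γ.vertexWeight x : ℝ) * h x ^ 2) / 2 := by
    rw [Finset.sum_div]
    refine Finset.sum_le_sum fun x _ => ?_
    rw [← Finset.sum_mul, mul_div_assoc]
    have := Γ.sum_weight_le_vertexWeight S x
    gcongr
  have h4 : ∑ x ∈ S, ∑ y ∈ S, (Γ.weight x y : ℝ) * (f y ^ 2 / 2)
      = ∑ x ∈ S, ∑ y ∈ S, (Γ.weight x y : ℝ) * (f x ^ 2 / 2) := by
    rw [Finset.sum_comm]
    simp_rw [Γ.weight_symm]
  have h5 := h3 f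
  have h6 := h3 g
  simp_rw [← pow_two] at h1
  linarith

lemma dist_le_succ_of_mem_neighbors (hconn : Γ.Connected) (z : V) {x y : V}
    (h : y ∈ Γ.neighbors x) :
    Γ.toSimpleGraph.dist z x ≤ Γ.toSimpleGraph.dist z y + 1 := by
  rw [mem_neighbors] at h
  by_cases hxy : y = x
  · subst hxy; omega
  have hadj : Γ.toSimpleGraph.Adj y x := ⟨hxy, by rwa [Γ.weight_symm]⟩
  have := hconn.dist_triangle (u := z) (v := y) (w := x)
  rwa [SimpleGraph.dist_eq_one_iff_adj.2 hadj] at this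

lemma markov_eq_zero_of_lt_dist (hconn : Γ.Connected) {z : V} {m : ℕ} {f : V → ℝ}
    (hf : ∀ x, m < Γ.toSimpleGraph.dist z x → f x = 0) {x : V}
    (hx : m + 1 < Γ.toSimpleGraph.dist z x) : Γ.markov f x = 0 := by
  refine Finset.sum_eq_zero fun y hy => ?_
  have := Γ.dist_le_succ_of_mem_neighbors hconn z hy
  rw [hf y (by omega), mul_zero]

lemma wave_eq_zero_of_lt_dist (hconn : Γ.Connected) (z : V) (m : ℕ) :
    ∀ x, m < Γ.toSimpleGraph.dist z x → Γ.wave z m x = 0 := by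
  have h0 : ∀ x, 0 < Γ.toSimpleGraph.dist z x → Γ.wave z 0 x = 0 := by
    intro x hx
    have : x ≠ z := by rintro rfl; simp at hx
    simp [wave, this]
  induction m using Nat.twoStepInduction with
  | zero => exact h0
  | one => exact fun x hx => Γ.markov_eq_zero_of_lt_dist hconn h0 hx
  | more m ih1 ih2 =>
    intro x hx
    simp only [wave]
    rw [Γ.markov_eq_zero_of_lt_dist hconn ih2 hx, ih1 x (by omega)]
    simp

/-! ### Energy and norm bounds for the wave. -/

variable {z : V} {M : ℕ} {S : Finset V}

/-- The left side does not depend on `j`: this is the wave equation together with the symmetry of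
`P`. At `j = 0` it is `‖δ_z‖² - ‖P δ_z‖²`, with norms taken over `S`. -/
lemma wave_energy (hμ : ∀ x, 0 < Γ.vertexWeight x) (hS : ∀ m ≤ M, ∀ x ∉ S, Γ.wave z m x = 0)
    {j : ℕ} (hj : j + 1 ≤ M) :
    ∑ x ∈ S, (Γ.vertexWeight x : ℝ) * Γ.wave z (j + 1) x ^ 2
      + ∑ x ∈ S, (Γ.vertexWeight x : ℝ) * Γ.wave z j x ^ 2
      - 2 * ∑ x ∈ S, (Γ.vertexWeight x : ℝ) * (Γ.markov (Γ.wave z j) x * Γ.wave z (j + 1) x)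
      ≤ ∑ x ∈ S, (Γ.vertexWeight x : ℝ) * Γ.wave z 0 x ^ 2 := by
  induction j with
  | zero =>
    have : (0 : ℝ) ≤ ∑ x ∈ S, (Γ.vertexWeight x : ℝ) * Γ.wave z 1 x ^ 2 :=
      Finset.sum_nonneg fun x _ => by positivity
    have h1 : ∑ x ∈ S, (Γ.vertexWeight x : ℝ) * (Γ.markov (Γ.wave z 0) x * Γ.wave z (0 + 1) x)
        = ∑ x ∈ S, (Γ.vertexWeight x : ℝ) * Γ.wave z 1 x ^ 2 :=
      Finset.sum_congr rfl fun x _ => by rw [pow_two]; rfl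
    rw [h1]
    simp only [zero_add]
    linarith
  | succ j ih =>
    refine le_trans (le_of_eq ?_) (ih (by omega))
    rw [Γ.markov_symm hμ (hS j (by omega)) (hS (j + 1) (by omega))]
    simp only [Finset.mul_sum, ← Finset.sum_add_distrib, ← Finset.sum_sub_distrib]
    refine Finset.sum_congr rfl fun x _ => ?_
    have : Γ.wave z (j + 1 + 1) x = 2 * Γ.markov (Γ.wave z (j + 1)) x - Γ.wave z j x := rfl
    rw [this]
    ring

/-- Completing the square, the energy is `‖u_{j+1} - P u_j‖² + ‖u_j‖² - ‖P u_j‖²`. As `P` contracts,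
each step adds at most `‖δ_z‖` to the norm. This linear growth is weaker than the spectral bound
`|T_j| ≤ 1` on `[-1, 1]`, but a polynomial loss is harmless. -/
lemma wave_sq_sum_le (hμ : ∀ x, 0 < Γ.vertexWeight x)
    (hS : ∀ m ≤ M, ∀ x ∉ S, Γ.wave z m x = 0) {j : ℕ} (hj : j ≤ M) :
    ∑ x ∈ S, (Γ.vertexWeight x : ℝ) * Γ.wave z j x ^ 2
      ≤ (j + 1) ^ 2 * ∑ x ∈ S, (Γ.vertexWeight x : ℝ) * Γ.wave z 0 x ^ 2 := by
  induction j with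
  | zero => simp
  | succ j ih =>
    have ih := ih (by omega)
    have hE := Γ.wave_energy hμ hS hj
    have hP := Γ.markov_contraction hμ (hS j (by omega))
    set E := ∑ x ∈ S, (Γ.vertexWeight x : ℝ) * Γ.wave z 0 x ^ 2
    set u := Γ.wave z (j + 1)
    set v := Γ.markov (Γ.wave z j)
    have hd : ∑ x ∈ S, (Γ.vertexWeight x : ℝ) * (u x - v x) ^ 2 ≤ E := by
      have : ∑ x ∈ S, (Γ.vertexWeight x : ℝ) * (u x - v x) ^ 2
          = ∑ x ∈ S, (Γ.vertexWeight x : ℝ) * u x ^ 2 + ∑ x ∈ S, (Γ.vertexWeight x : ℝ) * v x ^ 2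
            - 2 * ∑ x ∈ S, (Γ.vertexWeight x : ℝ) * (v x * u x) := by
        simp only [Finset.mul_sum, ← Finset.sum_add_distrib, ← Finset.sum_sub_distrib]
        exact Finset.sum_congr rfl fun x _ => by ring
      linarith
    -- Weighted Young inequality with `ε = 1 / (j + 1)`, chosen because `(1 + ε) (j + 1)² + (j + 2)
    -- = (j + 2)²`.
    have hpt : ∑ x ∈ S, (Γ.vertexWeight x : ℝ) * u x ^ 2
        ≤ (1 + 1 / ((j : ℝ) + 1)) * ∑ x ∈ S, (Γ.vertexWeight x : ℝ) * v x ^ 2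
          + (j + 2) * ∑ x ∈ S, (Γ.vertexWeight x : ℝ) * (u x - v x) ^ 2 := by
      simp only [Finset.mul_sum, ← Finset.sum_add_distrib]
      refine Finset.sum_le_sum fun x _ => ?_
      have hw : (0 : ℝ) ≤ Γ.vertexWeight x := NNReal.coe_nonneg _
      have hj1 : (0 : ℝ) < (j : ℝ) + 1 := by positivity
      have key : u x ^ 2 ≤ (1 + 1 / ((j : ℝ) + 1)) * v x ^ 2 + (j + 2) * (u x - v x) ^ 2 := by
        have : (1 + 1 / ((j : ℝ) + 1)) * v x ^ 2 + (j + 2) * (u x - v x) ^ 2 - u x ^ 2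
            = (v x - (j + 1) * (u x - v x)) ^ 2 / (j + 1) := by
          field_simp
          ring
        have : 0 ≤ (v x - (j + 1) * (u x - v x)) ^ 2 / ((j : ℝ) + 1) := by positivity
        linarith
      nlinarith [mul_le_mul_of_nonneg_left key hw]
    have hj1 : (0 : ℝ) < (j : ℝ) + 1 := by positivity
    calc _ ≤ _ := hpt
      _ ≤ (1 + 1 / ((j : ℝ) + 1)) * ((j + 1) ^ 2 * E) + (j + 2) * E := by
        gcongr
        exact hP.trans ih
      _ = _ := by
        push_cast
        field_simp
        ring

lemma wave_abs_sum_le (hμ : ∀ x, 0 < Γ.vertexWeight x)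
    (hS : ∀ m ≤ M, ∀ x ∉ S, Γ.wave z m x = 0) (hz : z ∈ S) {m : ℕ} (hm : m ≤ M) :
    ∑ x ∈ S, (Γ.vertexWeight x : ℝ) * |Γ.wave z m x|
      ≤ (M + 1) * √(Γ.vertexWeight z * ∑ x ∈ S, (Γ.vertexWeight x : ℝ)) := by
  classical
  have h0 : ∑ x ∈ S, (Γ.vertexWeight x : ℝ) * Γ.wave z 0 x ^ 2 = Γ.vertexWeight z := by
    rw [Finset.sum_eq_single z]
    · simp [wave]
    · intro x _ hx
      simp [wave, hx]
    · exact fun h => absurd hz h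
  have h1 := Γ.wave_sq_sum_le hμ hS hm
  rw [h0] at h1
  have h2 : (∑ x ∈ S, (Γ.vertexWeight x : ℝ) * |Γ.wave z m x|) ^ 2
      ≤ (∑ x ∈ S, (Γ.vertexWeight x : ℝ)) * ∑ x ∈ S, (Γ.vertexWeight x : ℝ) * Γ.wave z m x ^ 2 := by
    refine Finset.sum_sq_le_sum_mul_sum_of_sq_le_mul S (fun _ _ => NNReal.coe_nonneg _)
      (fun x _ => by positivity) fun x _ => le_of_eq ?_
    rw [mul_pow, sq_abs]
    ring
  have h3 : (0 : ℝ) ≤ ∑ x ∈ S, (Γ.vertexWeight x : ℝ) :=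
    Finset.sum_nonneg fun _ _ => NNReal.coe_nonneg _
  have hmM : (m : ℝ) ≤ M := by exact_mod_cast hm
  refine le_of_sq_le_sq ?_ (by positivity)
  rw [mul_pow, Real.sq_sqrt (by positivity)]
  calc _ ≤ _ := h2
    _ ≤ (∑ x ∈ S, (Γ.vertexWeight x : ℝ)) * ((m + 1) ^ 2 * Γ.vertexWeight z) := by gcongr
    _ ≤ (∑ x ∈ S, (Γ.vertexWeight x : ℝ)) * ((M + 1) ^ 2 * Γ.vertexWeight z) := by gcongr
    _ = _ := by ring

/-! ### Carne–Varopoulos estimate. -/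

lemma markov_add (f g : V → ℝ) : Γ.markov (f + g) = Γ.markov f + Γ.markov g := by
  ext x
  simp [markov, mul_add, Finset.sum_add_distrib]

lemma markov_smul (c : ℝ) (f : V → ℝ) : Γ.markov (c • f) = c • Γ.markov f := by
  ext x
  simp only [markov, Pi.smul_apply, smul_eq_mul, Finset.mul_sum]
  exact Finset.sum_congr rfl fun y _ => by ring

lemma iterate_markov_wave (k m : ℕ) :
    Γ.markov^[k + 1] (Γ.wave z (m + 1))
      = (1 / 2 : ℝ) • (Γ.markov^[k] (Γ.wave z (m + 2)) + Γ.markov^[k] (Γ.wave z m)) := by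
  induction k with
  | zero =>
    ext x
    simp only [zero_add, Function.iterate_one, Function.iterate_zero, id, Pi.smul_apply,
      Pi.add_apply, smul_eq_mul, wave]
    ring
  | succ k ih =>
    rw [Function.iterate_succ_apply', ih, markov_smul, markov_add,
      ← Function.iterate_succ_apply' Γ.markov, ← Function.iterate_succ_apply' Γ.markov]

/-- `P^k T_m(P)` is the mean of `T_{|m + X_k|}(P)` for a simple random walk `X` on `ℤ`. Waves of
index at most `R` vanish on `T`, and the others are paid for by an exponential Chebyshev bound:
`cosh (s m) * cosh s ^ k` satisfies the same recursion in `k` and `m`. -/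
lemma iterate_markov_wave_tail_le (T : Finset V) {D R s : ℝ} (hs : 0 ≤ s)
    (hD : ∀ m ≤ M, ∑ x ∈ T, (Γ.vertexWeight x : ℝ) * |Γ.wave z m x| ≤ D)
    (hT : ∀ m : ℕ, (m : ℝ) ≤ R → ∀ x ∈ T, Γ.wave z m x = 0) (k m : ℕ) (hkm : k + m ≤ M) :
    ∑ x ∈ T, (Γ.vertexWeight x : ℝ) * |Γ.markov^[k] (Γ.wave z m) x|
      ≤ 2 * D * Real.exp (-(s * R)) * (Real.cosh (s * m) * Real.cosh s ^ k) := by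
  have hD0 : 0 ≤ D := (Finset.sum_nonneg fun x _ => by positivity).trans (hD 0 (by omega))
  induction k generalizing m with
  | zero =>
    simp only [Function.iterate_zero, id, pow_zero, mul_one]
    by_cases hm : (m : ℝ) ≤ R
    · rw [Finset.sum_eq_zero fun x hx => by simp [hT m hm x hx]]
      have := Real.cosh_pos (s * m)
      positivity
    · refine (hD m (by omega)).trans ?_
      have h1 : 1 ≤ Real.exp (-(s * R)) * Real.exp (s * m) := by
        rw [← Real.exp_add]
        apply Real.one_le_exp
        nlinarith
      have h2 : Real.exp (s * m) ≤ 2 * Real.cosh (s * m) := by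
        rw [Real.cosh_eq]
        linarith [Real.exp_pos (-(s * m))]
      calc D = D * 1 := (mul_one D).symm
        _ ≤ D * (Real.exp (-(s * R)) * (2 * Real.cosh (s * m))) := by
          gcongr
          exact h1.trans (by gcongr)
        _ = _ := by ring
  | succ k ih =>
    cases m with
    -- Reflection at index `0`: `P T_0 = T_1`, matched by `cosh 0 = 1`.
    | zero =>
      have := ih 1 (by omega)
      rw [Function.iterate_succ_apply]
      refine this.trans (le_of_eq ?_)
      simp [pow_succ']
    | succ m =>
      rw [iterate_markov_wave]
      have h1 := ih (m + 2) (by omega)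
      have h2 := ih m (by omega)
      have hc : Real.cosh (s * ((m + 2 : ℕ) : ℝ)) + Real.cosh (s * m)
          = 2 * (Real.cosh (s * ((m + 1 : ℕ) : ℝ)) * Real.cosh s) := by
        have e1 : s * ((m + 2 : ℕ) : ℝ) = s * ((m + 1 : ℕ) : ℝ) + s := by push_cast; ring
        have e2 : s * (m : ℝ) = s * ((m + 1 : ℕ) : ℝ) - s := by push_cast; ring
        rw [e1, e2, Real.cosh_add, Real.cosh_sub]
        ring
      calc _ ≤ ∑ x ∈ T, (1 / 2 * ((Γ.vertexWeight x : ℝ) * |Γ.markov^[k] (Γ.wave z (m + 2)) x|)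
            + 1 / 2 * ((Γ.vertexWeight x : ℝ) * |Γ.markov^[k] (Γ.wave z m) x|)) := by
            refine Finset.sum_le_sum fun x _ => ?_
            simp only [Pi.smul_apply, Pi.add_apply, smul_eq_mul, abs_mul]
            rw [abs_of_pos (by norm_num : (0 : ℝ) < 1 / 2)]
            have := abs_add_le (Γ.markov^[k] (Γ.wave z (m + 2)) x) (Γ.markov^[k] (Γ.wave z m) x)
            have hw : (0 : ℝ) ≤ Γ.vertexWeight x := NNReal.coe_nonneg _
            nlinarith [mul_le_mul_of_nonneg_left this hw]
        _ ≤ 1 / 2 * (2 * D * Real.exp (-(s * R))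
              * (Real.cosh (s * ((m + 2 : ℕ) : ℝ)) * Real.cosh s ^ k))
            + 1 / 2 * (2 * D * Real.exp (-(s * R)) * (Real.cosh (s * m) * Real.cosh s ^ k)) := by
            rw [Finset.sum_add_distrib, ← Finset.mul_sum, ← Finset.mul_sum]
            gcongr
        _ = D * Real.exp (-(s * R)) * Real.cosh s ^ k
              * (Real.cosh (s * ((m + 2 : ℕ) : ℝ)) + Real.cosh (s * m)) := by ring
        _ = _ := by rw [hc]; ring

lemma coe_stepTransition (z : V) (k : ℕ) :
    (fun x => (Γ.stepTransition k x z : ℝ)) = Γ.markov^[k] (Γ.wave z 0) := by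
  classical
  induction k with
  | zero =>
    ext x
    by_cases h : x = z <;> simp [stepTransition, wave, h]
  | succ k ih =>
    rw [Function.iterate_succ_apply', ← ih]
    ext x
    simp [stepTransition, markov]

lemma iterate_markov_eq_zero_of_lt_dist (hconn : Γ.Connected) (z : V) (k : ℕ) :
    ∀ x, k < Γ.toSimpleGraph.dist z x → Γ.markov^[k] (Γ.wave z 0) x = 0 := by
  induction k with
  | zero => exact Γ.wave_eq_zero_of_lt_dist hconn z 0
  | succ k ih =>
    intro x hx
    rw [Function.iterate_succ_apply']
    exact Γ.markov_eq_zero_of_lt_dist hconn ih hx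

/-- The measure `μ` is invariant for the random walk. -/
lemma sum_vertexWeight_mul_stepTransition (hconn : Γ.Connected) (hμ : ∀ x, 0 < Γ.vertexWeight x)
    (z : V) {M : ℕ} {S : Finset V} (hS : ∀ x, Γ.toSimpleGraph.dist z x ≤ M → x ∈ S) {k : ℕ}
    (hk : k ≤ M) :
    ∑ x ∈ S, (Γ.vertexWeight x : ℝ) * Γ.stepTransition k x z = Γ.vertexWeight z := by
  classical
  have hrw (k : ℕ) (x : V) : (Γ.stepTransition k x z : ℝ) = Γ.markov^[k] (Γ.wave z 0) x :=
    congrFun (Γ.coe_stepTransition z k) x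
  simp only [hrw]
  induction k with
  | zero =>
    rw [Finset.sum_eq_single z]
    · simp [wave]
    · intro x _ hx
      simp [wave, hx]
    · exact fun h => absurd (hS z (by simp)) h
  | succ k ih =>
    rw [← ih (by omega)]
    set f := Γ.markov^[k] (Γ.wave z 0) with hf
    have hsupp := Γ.iterate_markov_eq_zero_of_lt_dist hconn z k
    have hf0 : ∀ y ∉ S, f y = 0 := fun y hy => hsupp y (by
      by_contra h
      exact hy (hS y (by omega)))
    simp only [Function.iterate_succ_apply', ← hf]
    rw [Finset.sum_congr rfl fun x _ => Γ.vertexWeight_mul_markov (hμ x) hf0, Finset.sum_comm]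
    refine Finset.sum_congr rfl fun y _ => ?_
    rw [← Finset.sum_mul]
    by_cases hy : k < Γ.toSimpleGraph.dist z y
    · have hfy : f y = 0 := hsupp y hy
      rw [hfy, mul_zero, mul_zero]
    · congr 1
      simp_rw [fun x => Γ.weight_symm x y]
      refine Γ.sum_weight_eq_vertexWeight fun x hx => hS x ?_
      rw [mem_neighbors, Γ.weight_symm, ← mem_neighbors] at hx
      have := Γ.dist_le_succ_of_mem_neighbors hconn z hx
      omega

/-- A lower bound, of Carne-Varopoulos type, for the probability that the random walk is still in a
ball at time `k`. -/
lemma sum_ball_vertexWeight_mul_stepTransition_ge (hconn : Γ.Connected)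
    (hμ : ∀ x, 0 < Γ.vertexWeight x) (z : V) {M : ℕ} {S : Finset V}
    (hS : ∀ x, Γ.toSimpleGraph.dist z x ≤ M → x ∈ S) {k : ℕ} (hk : k ≤ M) {R : ℝ} (hR : 0 ≤ R)
    (hM : 0 < M) :
    (Γ.vertexWeight z : ℝ) - 2 * ((M + 1) * √(Γ.vertexWeight z * ∑ x ∈ S, (Γ.vertexWeight x : ℝ)))
        * Real.exp (-(R ^ 2 / (2 * M)))
      ≤ ∑ x ∈ S with (Γ.toSimpleGraph.dist z x : ℝ) ≤ R,
        (Γ.vertexWeight x : ℝ) * Γ.stepTransition k x z := by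
  have hSw : ∀ m ≤ M, ∀ x ∉ S, Γ.wave z m x = 0 := fun m hm x hx =>
    Γ.wave_eq_zero_of_lt_dist hconn z m x (by
      by_contra h
      exact hx (hS x (by omega)))
  have hzS : z ∈ S := hS z (by simp)
  set D := ((M : ℝ) + 1) * √(Γ.vertexWeight z * ∑ x ∈ S, (Γ.vertexWeight x : ℝ))
  have hD0 : 0 ≤ D := by positivity
  have hM' : (0 : ℝ) < M := by exact_mod_cast hM
  -- `s = R / M` minimises the exponent `-s R + M s² / 2`.
  have htail := Γ.iterate_markov_wave_tail_le (z := z) (M := M)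
    {x ∈ S | ¬ (Γ.toSimpleGraph.dist z x : ℝ) ≤ R} (D := D) (R := R) (s := R / M) (by positivity)
    (fun m hm => (Finset.sum_le_sum_of_subset_of_nonneg (Finset.filter_subset _ _)
      fun _ _ _ => by positivity).trans (Γ.wave_abs_sum_le hμ hSw hzS hm))
    (fun m hm x hx => Γ.wave_eq_zero_of_lt_dist hconn z m x (by
      have := (Finset.mem_filter.1 hx).2
      have : (m : ℝ) < Γ.toSimpleGraph.dist z x := by linarith
      exact_mod_cast this)) k 0 (by omega)
  have hexp : Real.exp (-(R / M * R)) * Real.cosh (R / M) ^ k ≤ Real.exp (-(R ^ 2 / (2 * M))) := by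
    calc _ ≤ Real.exp (-(R / M * R)) * Real.exp ((R / M) ^ 2 / 2) ^ k := by
          gcongr
          exact Real.cosh_le_exp_half_sq _
      _ ≤ Real.exp (-(R / M * R)) * Real.exp ((R / M) ^ 2 / 2) ^ M := by
          gcongr
          exact Real.one_le_exp (by positivity)
      _ = _ := by
          rw [← Real.exp_nat_mul, ← Real.exp_add]
          congr 1
          field_simp
          ring
  have htot := Γ.sum_vertexWeight_mul_stepTransition hconn hμ z hS hk
  rw [← Finset.sum_filter_add_sum_filter_not S
    (fun x => (Γ.toSimpleGraph.dist z x : ℝ) ≤ R)] at htot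
  have heq : ∑ x ∈ S with ¬ (Γ.toSimpleGraph.dist z x : ℝ) ≤ R,
      (Γ.vertexWeight x : ℝ) * Γ.stepTransition k x z
      = ∑ x ∈ S with ¬ (Γ.toSimpleGraph.dist z x : ℝ) ≤ R,
        (Γ.vertexWeight x : ℝ) * |Γ.markov^[k] (Γ.wave z 0) x| := by
    refine Finset.sum_congr rfl fun x _ => ?_
    rw [← Γ.coe_stepTransition z k, abs_of_nonneg (NNReal.coe_nonneg _)]
  rw [heq] at htot
  have : 2 * D * Real.exp (-(R / M * R)) * (Real.cosh (R / M * (0 : ℕ)) * Real.cosh (R / M) ^ k)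
      ≤ 2 * D * Real.exp (-(R ^ 2 / (2 * M))) := by
    simp only [Nat.cast_zero, mul_zero, Real.cosh_zero, one_mul]
    rw [mul_assoc]
    gcongr
  linarith

/-! ### Lower bound for the occupation of one block of times. -/

/-- By Hölder's inequality, a function of large integral over a set of small measure has large
`L^q`-norm, for `q = p / (p - 1)`. -/
lemma div_le_sum_mul_rpow {ι : Type*} (T : Finset ι) {μ w : ι → ℝ} (hμ : ∀ x, 0 ≤ μ x)
    (hw : ∀ x, 0 ≤ w x) {p n L m K : ℝ} (hp : 1 < p) (hn : 0 < n) (hL : 0 < L) (hm : 0 ≤ m)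
    (hK : 0 < K) (hmass : n * m ≤ ∑ x ∈ T, μ x * w x)
    (hvol : ∑ x ∈ T, μ x ≤ K * (n ^ p * L ^ (p - 1))) :
    m ^ (p / (p - 1)) / K ^ (p / (p - 1) - 1) / L ≤ ∑ x ∈ T, μ x * w x ^ (p / (p - 1)) := by
  have hp1 : 0 < p - 1 := by linarith
  obtain ⟨q, hq⟩ : ∃ q, q = p / (p - 1) := ⟨_, rfl⟩
  have hq1 : q - 1 = 1 / (p - 1) := by rw [hq]; field_simp; ring
  have hq0 : 1 < q := by
    have : 0 < 1 / (p - 1) := by positivity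
    linarith
  -- These two identities turn the volume factor into `n^q * L`: the powers of `n` cancel against
  -- the mass and a single `L` survives.
  have e1 : p * (q - 1) = q := by rw [hq1, hq]; field_simp
  have e2 : (p - 1) * (q - 1) = 1 := by rw [hq1]; field_simp
  rw [← hq]
  have hX0 : 0 ≤ ∑ x ∈ T, μ x * w x ^ q :=
    Finset.sum_nonneg fun x _ => mul_nonneg (hμ x) (Real.rpow_nonneg (hw x) q)
  have hholder := hmass.trans (Real.inner_le_weight_mul_Lp_of_nonneg T hq0.le μ w hμ hw)
  have hW0 : 0 ≤ ∑ x ∈ T, μ x := Finset.sum_nonneg fun x _ => hμ x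
  generalize ∑ x ∈ T, μ x * w x ^ q = X at *
  generalize ∑ x ∈ T, μ x = W at *
  have hmain : (n * m) ^ q ≤ K ^ (q - 1) * (n ^ q * L) * X := by
    calc _ ≤ (W ^ (1 - q⁻¹) * X ^ q⁻¹) ^ q :=
          Real.rpow_le_rpow (by positivity) hholder (by linarith)
      _ = W ^ (q - 1) * X := by
          rw [Real.mul_rpow (by positivity) (by positivity), ← Real.rpow_mul hW0,
            ← Real.rpow_mul hX0, inv_mul_cancel₀ (by linarith), Real.rpow_one]
          congr 2
          field_simp
      _ ≤ (K * (n ^ p * L ^ (p - 1))) ^ (q - 1) * X :=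
          mul_le_mul_of_nonneg_right (Real.rpow_le_rpow hW0 hvol (by linarith)) hX0
      _ = _ := by
          rw [Real.mul_rpow hK.le (by positivity), Real.mul_rpow (by positivity) (by positivity),
            ← Real.rpow_mul hn.le, ← Real.rpow_mul hL.le, e1, e2, Real.rpow_one]
  rw [Real.mul_rpow hn.le hm] at hmain
  have hnq : 0 < n ^ q := by positivity
  have hKq : 0 < K ^ (q - 1) := by positivity
  rw [div_div, div_le_iff₀ (by positivity)]
  have : n ^ q * m ^ q ≤ n ^ q * (X * (K ^ (q - 1) * L)) := hmain.trans (le_of_eq (by ring))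
  exact le_of_mul_le_mul_left this hnq

/-- Under the volume growth `V(z, r) ≤ C r^{2p} / log r`, the expected occupation
`∑_{n ≤ k < 2n} P_k(·, z)` has `L^q`-norm to the `q` at least `c / log n`. -/
lemma exists_le_sum_occupation_rpow (hconn : Γ.Connected) (hμ : ∀ x, 0 < Γ.vertexWeight x)
    (z : V) (hfin : ∀ r, (Γ.ball z r).Finite) {p : ℝ} (hp : 1 < p) {C : ℝ} (hC : 0 < C)
    (hV : ∀ᶠ r : ℝ in atTop, ∑ x ∈ (hfin r).toFinset, (Γ.vertexWeight x : ℝ)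
      ≤ C * (r ^ (2 * p) / Real.log r)) :
    ∃ c : ℝ, 0 < c ∧ ∀ᶠ n : ℕ in atTop, ∃ T : Finset V, c / Real.log n
      ≤ ∑ x ∈ T, (Γ.vertexWeight x : ℝ) *
        (∑ k ∈ Finset.Ico n (2 * n), (Γ.stepTransition k x z : ℝ)) ^ (p / (p - 1)) := by
  set m := (Γ.vertexWeight z : ℝ) with hm
  have hm0 : 0 < m := by exact_mod_cast hμ z
  set q := p / (p - 1) with hq
  have hp1 : 0 < p - 1 := by linarith
  -- With `R² = A n log n` and times up to `2n`, the Gaussian factor is `n^(-(p+2))`; it beats the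
  -- prefactor of order `n * n^p` and leaves `O(1 / n)`.
  set A : ℝ := 4 * (p + 2) with hA
  have hA0 : 1 ≤ A := by rw [hA]; linarith
  set K : ℝ := 2 * C * A ^ p with hK
  have hK0 : 0 < K := by positivity
  refine ⟨(m / 2) ^ q / K ^ (q - 1), by positivity, ?_⟩
  have hcast : Tendsto (fun n : ℕ => (n : ℝ)) atTop atTop := tendsto_natCast_atTop_atTop
  have hlog : Tendsto (fun n : ℕ => Real.log n) atTop atTop := Real.tendsto_log_atTop.comp hcast
  have hR : Tendsto (fun n : ℕ => √(A * n * Real.log n)) atTop atTop :=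
    Real.tendsto_sqrt_atTop.comp ((hcast.const_mul_atTop (by linarith)).atTop_mul_atTop₀ hlog)
  have h2n : Tendsto (fun n : ℕ => 2 * (n : ℝ)) atTop atTop :=
    hcast.const_mul_atTop (by norm_num)
  filter_upwards [hR.eventually hV, h2n.eventually hV, hlog.eventually_ge_atTop 1,
    hcast.eventually_ge_atTop 1, hcast.eventually_ge_atTop (6 * (√(m * C) * 2 ^ p) / (m / 2))]
    with n hVR hV2 hL hn1 hnbig
  set L := Real.log n with hLdef
  set R := √(A * n * L) with hRdef
  have hn0 : (0 : ℝ) < n := by linarith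
  have hnpos : 0 < n := by exact_mod_cast hn0
  have hL0 : 0 < L := by linarith
  have hRsq : R ^ 2 = A * n * L := Real.sq_sqrt (by positivity)
  set S := (hfin (2 * n)).toFinset with hSdef
  set T := S.filter (fun x => (Γ.toSimpleGraph.dist z x : ℝ) ≤ R) with hT
  refine ⟨T, ?_⟩
  have hS : ∀ x, Γ.toSimpleGraph.dist z x ≤ 2 * n → x ∈ S := fun x hx => by
    rw [hSdef, Set.Finite.mem_toFinset]
    change (Γ.toSimpleGraph.dist z x : ℝ) ≤ 2 * n
    exact_mod_cast hx
  -- the walk stays in the ball of radius `R` with probability at least one half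
  have herr : 2 * (((2 * n : ℕ) + 1 : ℝ) * √(m * ∑ x ∈ S, (Γ.vertexWeight x : ℝ)))
      * Real.exp (-(R ^ 2 / (2 * (2 * n : ℕ)))) ≤ m / 2 := by
    have he : Real.exp (-(R ^ 2 / (2 * (2 * n : ℕ)))) = (n : ℝ) ^ (-(p + 2)) := by
      rw [Real.rpow_def_of_pos hn0, hRsq]
      congr 1
      push_cast
      rw [hA, ← hLdef]
      field_simp
      norm_num
    have hlog2 : 1 ≤ Real.log (2 * n) :=
      hL.trans (Real.log_le_log hn0 (by linarith))
    have hvol : ∑ x ∈ S, (Γ.vertexWeight x : ℝ) ≤ C * ((2 * (n : ℝ)) ^ p) ^ 2 := by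
      refine hV2.trans ?_
      rw [mul_comm 2 p, Real.rpow_mul (by positivity), Real.rpow_two]
      gcongr
      exact div_le_self (by positivity) hlog2
    have hsq : √(m * ∑ x ∈ S, (Γ.vertexWeight x : ℝ)) ≤ √(m * C) * (2 * (n : ℝ)) ^ p := by
      calc _ ≤ √(m * C * ((2 * (n : ℝ)) ^ p) ^ 2) := by
            apply Real.sqrt_le_sqrt
            rw [mul_assoc]
            gcongr
        _ = _ := by rw [Real.sqrt_mul (by positivity), Real.sqrt_sq (by positivity)]
    have hpow : (n : ℝ) ^ (-(p + 2)) * (2 * (n : ℝ)) ^ p = 2 ^ p / (n : ℝ) ^ 2 := by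
      rw [Real.mul_rpow (by norm_num) hn0.le, Real.rpow_neg hn0.le, Real.rpow_add hn0,
        Real.rpow_two]
      field_simp
    calc _ ≤ 2 * ((3 * n) * (√(m * C) * (2 * (n : ℝ)) ^ p)) * (n : ℝ) ^ (-(p + 2)) := by
          rw [he]
          gcongr
          push_cast
          linarith
      _ = 6 * n * √(m * C) * ((n : ℝ) ^ (-(p + 2)) * (2 * (n : ℝ)) ^ p) := by ring
      _ = 6 * (√(m * C) * 2 ^ p) / n := by
          rw [hpow]
          field_simp
      _ ≤ m / 2 := by
          rw [div_le_iff₀ (by positivity)] at hnbig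
          rw [div_le_iff₀ hn0]
          linarith
  have hmass : n * (m / 2) ≤ ∑ x ∈ T, (Γ.vertexWeight x : ℝ) *
      ∑ k ∈ Finset.Ico n (2 * n), (Γ.stepTransition k x z : ℝ) := by
    simp_rw [Finset.mul_sum]
    rw [Finset.sum_comm]
    have : ∀ k ∈ Finset.Ico n (2 * n), m / 2
        ≤ ∑ x ∈ T, (Γ.vertexWeight x : ℝ) * Γ.stepTransition k x z := by
      intro k hk
      have := Γ.sum_ball_vertexWeight_mul_stepTransition_ge hconn hμ z hS
        (Finset.mem_Ico.1 hk).2.le (R := R) (by positivity) (by omega)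
      linarith
    have := Finset.card_nsmul_le_sum _ _ _ this
    rw [Nat.card_Ico, nsmul_eq_mul] at this
    rwa [show 2 * n - n = n by omega] at this
  -- the volume of that ball
  have hvolT : ∑ x ∈ T, (Γ.vertexWeight x : ℝ) ≤ K * ((n : ℝ) ^ p * L ^ (p - 1)) := by
    -- `R² ≥ n`, so the denominator `log R` costs only the factor `2` in `K`.
    have hlogR : L / 2 ≤ Real.log R := by
      rw [hRdef, Real.log_sqrt (by positivity)]
      gcongr
      refine Real.log_le_log hn0 ?_
      have : 1 ≤ A * L := one_le_mul_of_one_le_of_one_le hA0 hL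
      nlinarith
    calc _ ≤ ∑ x ∈ (hfin R).toFinset, (Γ.vertexWeight x : ℝ) := by
          refine Finset.sum_le_sum_of_subset_of_nonneg (fun x hx => ?_)
            fun _ _ _ => NNReal.coe_nonneg _
          rw [Set.Finite.mem_toFinset]
          exact (Finset.mem_filter.1 hx).2
      _ ≤ C * (R ^ (2 * p) / Real.log R) := hVR
      _ ≤ C * (R ^ (2 * p) / (L / 2)) := by gcongr
      _ = _ := by
          rw [Real.rpow_mul (by positivity), Real.rpow_two, hRsq,
            Real.mul_rpow (by positivity) hL0.le, Real.mul_rpow (by linarith) hn0.le,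
            Real.rpow_sub_one hL0.ne', hK]
          field_simp
  exact div_le_sum_mul_rpow T (fun _ => NNReal.coe_nonneg _) (fun x => by positivity) hp hn0 hL0
    (by positivity) hK0 hmass hvolT

/-! ### Summing the dyadic blocks. -/

/-- Dyadic blocks: superadditivity of `t ↦ t^q` lets the `L^q`-masses of the blocks add up. -/
lemma sum_dyadic_rpow_le {q : ℝ} (hq : 1 ≤ q) (μ : V → ℝ≥0∞) (a : ℕ → V → ℝ≥0∞) (i J : ℕ) :
    ∑ j ∈ Finset.Ico i J,
      ∑' x, (∑ k ∈ Finset.Ico (2 ^ j) (2 * 2 ^ j), a k x) ^ q * μ x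
      ≤ ∑' x, (∑ k ∈ Finset.range (2 ^ J), a k x) ^ q * μ x := by
  induction J with
  | zero => simp
  | succ J ih =>
    by_cases hiJ : i ≤ J
    · rw [Finset.sum_Ico_succ_top hiJ]
      refine (add_le_add_left ih _).trans ?_
      rw [← ENNReal.tsum_add]
      refine ENNReal.tsum_le_tsum fun x => ?_
      rw [← add_mul, pow_succ', ← Finset.sum_range_add_sum_Ico (fun k => a k x)
        (by omega : 2 ^ J ≤ 2 * 2 ^ J)]
      gcongr
      exact ENNReal.add_rpow_le_rpow_add _ _ hq
    · rw [Finset.Ico_eq_empty (by omega)]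
      simp

lemma tsum_occupation_rpow_eq_top (hconn : Γ.Connected) (hμ : ∀ x, 0 < Γ.vertexWeight x)
    (z : V) (hfin : ∀ r, (Γ.ball z r).Finite) {p : ℝ} (hp : 1 < p) {C : ℝ} (hC : 0 < C)
    (hV : ∀ᶠ r : ℝ in atTop, ∑ x ∈ (hfin r).toFinset, (Γ.vertexWeight x : ℝ)
      ≤ C * (r ^ (2 * p) / Real.log r)) :
    ∑' x, (∑' k, (Γ.stepTransition k x z : ℝ≥0∞)) ^ (p / (p - 1)) * (Γ.vertexWeight x : ℝ≥0∞)
      = ∞ := by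
  obtain ⟨c, hc, hev⟩ := Γ.exists_le_sum_occupation_rpow hconn hμ z hfin hp hC hV
  have hp1 : 0 < p - 1 := by linarith
  set q := p / (p - 1) with hq
  have hq1 : 1 ≤ q := by rw [hq, le_div_iff₀ hp1]; linarith
  obtain ⟨i, hi⟩ := eventually_atTop.1 ((tendsto_pow_atTop_atTop_of_one_lt
    (by norm_num : 1 < 2)).eventually hev)
  set F := ∑' x, (∑' k, (Γ.stepTransition k x z : ℝ≥0∞)) ^ q * (Γ.vertexWeight x : ℝ≥0∞) with hF
  by_contra hne
  have hblock : ∀ j, i ≤ j → ENNReal.ofReal (c / Real.log 2 * (1 / j))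
      ≤ ∑' x, (∑ k ∈ Finset.Ico (2 ^ j) (2 * 2 ^ j), (Γ.stepTransition k x z : ℝ≥0∞)) ^ q
        * (Γ.vertexWeight x : ℝ≥0∞) := by
    intro j hj
    obtain ⟨T, hT⟩ := hi j hj
    refine le_trans ?_ (ENNReal.sum_le_tsum T)
    -- At `j = 0` both sides are `0` by division by zero, so the threshold `i` need not be positive.
    have e1 : c / Real.log 2 * (1 / j) = c / Real.log ((2 ^ j : ℕ) : ℝ) := by
      push_cast
      rw [Real.log_pow, div_mul_div_comm, mul_one, mul_comm (Real.log 2)]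
    rw [e1]
    refine (ENNReal.ofReal_le_ofReal hT).trans (le_of_eq ?_)
    rw [ENNReal.ofReal_sum_of_nonneg fun x _ => by positivity]
    refine Finset.sum_congr rfl fun x _ => ?_
    rw [mul_comm, ENNReal.ofReal_mul (by positivity), ENNReal.ofReal_coe_nnreal,
      ← ENNReal.ofReal_rpow_of_nonneg (by positivity) (by linarith),
      ENNReal.ofReal_sum_of_nonneg fun _ _ => NNReal.coe_nonneg _]
    simp only [ENNReal.ofReal_coe_nnreal]
  have hbound : ∀ J, ENNReal.ofReal (∑ j ∈ Finset.Ico i J, c / Real.log 2 * (1 / (j : ℝ))) ≤ F := by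
    intro J
    have hlog2 : 0 < Real.log 2 := Real.log_pos (by norm_num)
    rw [ENNReal.ofReal_sum_of_nonneg fun j _ => by positivity]
    calc _ ≤ _ := Finset.sum_le_sum fun j hj => hblock j (Finset.mem_Ico.1 hj).1
      _ ≤ _ := sum_dyadic_rpow_le hq1 _ _ i J
      _ ≤ F := by
          refine ENNReal.tsum_le_tsum fun x => ?_
          gcongr
          exact ENNReal.sum_le_tsum _
  have hlog2 : 0 < Real.log 2 := Real.log_pos (by norm_num)
  have hsum : Summable fun j : ℕ => c / Real.log 2 * (1 / (j : ℝ)) := by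
    refine summable_of_sum_range_le (c := ∑ j ∈ Finset.range i, c / Real.log 2 * (1 / (j : ℝ))
      + F.toReal) (fun j => by positivity) fun J => ?_
    have h1 : ∑ j ∈ Finset.Ico i (max i J), c / Real.log 2 * (1 / (j : ℝ)) ≤ F.toReal :=
      (ENNReal.ofReal_le_iff_le_toReal hne).1 (hbound _)
    calc _ ≤ ∑ j ∈ Finset.range (max i J), c / Real.log 2 * (1 / (j : ℝ)) :=
          Finset.sum_le_sum_of_subset_of_nonneg
            (Finset.range_mono (le_max_right _ _)) fun j _ _ => by positivity
      _ ≤ _ := by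
          rw [← Finset.sum_range_add_sum_Ico _ (le_max_left i J)]
          gcongr
  rw [summable_mul_left_iff (by positivity)] at hsum
  exact Real.not_summable_one_div_natCast hsum

/-! ### Balls, volumes and the Green operator. -/

lemma ball_subset_ball_of_dist_le (hconn : Γ.Connected) {o z : V} {r : ℝ}
    (h : (Γ.toSimpleGraph.dist o z : ℝ) ≤ r) : Γ.ball z r ⊆ Γ.ball o (2 * r) := by
  intro x hx
  have hx : (Γ.toSimpleGraph.dist z x : ℝ) ≤ r := hx
  have := hconn.dist_triangle (u := o) (v := z) (w := x)
  have : (Γ.toSimpleGraph.dist o x : ℝ) ≤ Γ.toSimpleGraph.dist o z + Γ.toSimpleGraph.dist z x := by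
    exact_mod_cast this
  change (Γ.toSimpleGraph.dist o x : ℝ) ≤ 2 * r
  linarith

lemma coe_sum_vertexWeight_le_volume {o : V} {r : ℝ} {s : Finset V} (hs : ↑s ⊆ Γ.ball o r) :
    ((∑ x ∈ s, Γ.vertexWeight x : ℝ≥0) : ℝ≥0∞) ≤ Γ.volume o r := by
  unfold volume
  rw [tsum_subtype (Γ.ball o r) fun x => (Γ.vertexWeight x : ℝ≥0∞)]
  push_cast
  refine le_trans (le_of_eq ?_) (ENNReal.sum_le_tsum s)
  exact Finset.sum_congr rfl fun x hx => by rw [Set.indicator_of_mem (hs hx)]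

lemma ball_finite_of_volume_ne_top {b : ℝ≥0} (hb : 0 < b) (hμ : ∀ x, b ≤ Γ.vertexWeight x)
    {o : V} {r : ℝ} (h : Γ.volume o r ≠ ∞) : (Γ.ball o r).Finite := by
  have := ENNReal.finite_const_le_of_tsum_ne_top h (ε := b) (by simpa using hb.ne')
  have huniv : {x : Γ.ball o r | (b : ℝ≥0∞) ≤ (Γ.vertexWeight x : ℝ≥0∞)} = Set.univ :=
    Set.eq_univ_of_forall fun x => by
      simpa using hμ x
  rw [huniv, Set.finite_univ_iff] at this
  exact Set.toFinite _

/-- Only the term `y = z` is kept; its weight `μ(z)` cancels the normalisation of the heat kernel.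
-/
lemma mul_tsum_stepTransition_le_greenOp {z : V} (hz : 0 < Γ.vertexWeight z) (f : V → ℝ≥0)
    (x : V) :
    (f z : ℝ≥0∞) * ∑' k, (Γ.stepTransition k x z : ℝ≥0∞) ≤ Γ.greenOp f x := by
  refine le_trans (le_of_eq ?_) (ENNReal.le_tsum z)
  have : Γ.green x z * (Γ.vertexWeight z : ℝ≥0∞) = ∑' k, (Γ.stepTransition k x z : ℝ≥0∞) := by
    unfold green heatKernel
    rw [← ENNReal.tsum_mul_right]
    refine tsum_congr fun k => ?_
    rw [← ENNReal.coe_mul, div_mul_cancel₀ _ hz.ne']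
  rw [← this]
  ring

end WeightedGraph

end

theorem theorem1p2 {V : Type*} [Infinite V] (Γ : WeightedGraph V) (hconn : Γ.Connected)
    (p : ℝ) (hp1 : 1 < p) (hp2 : p ≤ 2)
    (hμ : ∃ b : ℝ≥0, 0 < b ∧ ∀ x, b ≤ Γ.vertexWeight x)
    (hV : ∃ o : V, ∃ C : ℝ, 0 < C ∧ ∀ᶠ r : ℝ in atTop,
      Γ.volume o r ≤ ENNReal.ofReal (C * (r ^ (2 * p) / Real.log r))) :
    Γ.IsLpParabolic p := by
  obtain ⟨b, hb, hμb⟩ := hμ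
  obtain ⟨o, C, hC, hV⟩ := hV
  have hμ : ∀ x, 0 < Γ.vertexWeight x := fun x => hb.trans_le (hμb x)
  have hfino : ∀ᶠ r : ℝ in atTop, (Γ.ball o r).Finite := by
    filter_upwards [hV] with r hr
    exact Γ.ball_finite_of_volume_ne_top hb hμb (hr.trans_lt ENNReal.ofReal_lt_top).ne
  have h2 : Tendsto (fun r : ℝ => 2 * r) atTop atTop :=
    tendsto_id.const_mul_atTop (by norm_num)
  have hfin : ∀ z r, (Γ.ball z r).Finite := by
    intro z r
    obtain ⟨s, hs1, hs2, hs3⟩ := ((h2.eventually hfino).and ((eventually_ge_atTop r).and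
      (eventually_ge_atTop (Γ.toSimpleGraph.dist o z : ℝ)))).exists
    exact hs1.subset (subset_trans (fun x hx => le_trans hx hs2)
      (Γ.ball_subset_ball_of_dist_le hconn hs3))
  -- Recentring from `o` to `z` doubles the radius, hence the factor `2 ^ (2 * p)`.
  have hVz : ∀ z, ∀ᶠ r : ℝ in atTop, ∑ x ∈ (hfin z r).toFinset, (Γ.vertexWeight x : ℝ)
      ≤ (C * 2 ^ (2 * p)) * (r ^ (2 * p) / Real.log r) := by
    intro z
    filter_upwards [h2.eventually hV, eventually_gt_atTop 1,
      eventually_ge_atTop (Γ.toSimpleGraph.dist o z : ℝ)] with r hr hr1 hrz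
    have hlog : 0 < Real.log r := Real.log_pos hr1
    have hlog2 : Real.log r ≤ Real.log (2 * r) := Real.log_le_log (by linarith) (by linarith)
    have hsub : ((hfin z r).toFinset : Set V) ⊆ Γ.ball o (2 * r) := by
      rw [Set.Finite.coe_toFinset]
      exact Γ.ball_subset_ball_of_dist_le hconn hrz
    have h := (Γ.coe_sum_vertexWeight_le_volume hsub).trans hr
    have hlog2' : 0 < Real.log (2 * r) := hlog.trans_le hlog2
    rw [← ENNReal.ofReal_coe_nnreal, ENNReal.ofReal_le_ofReal_iff (by positivity)] at h
    push_cast at h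
    refine h.trans ?_
    rw [Real.mul_rpow (by norm_num) (by linarith), mul_assoc C, ← mul_div_assoc (2 ^ (2 * p) : ℝ)]
    gcongr
  intro K
  refine le_antisymm (sSup_le ?_) bot_le
  rintro c ⟨f, -, hf, rfl⟩
  have hp0 : 0 < p := by linarith
  have hq0 : 0 < p / (p - 1) := div_pos hp0 (by linarith)
  have hfz : ∀ z, f z = 0 := by
    intro z
    by_contra hz
    have htop := Γ.tsum_occupation_rpow_eq_top hconn hμ z (hfin z) hp1 (by positivity) (hVz z)
    -- A single vertex with `f z ≠ 0` already makes the norm of `G f` infinite, against the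
    -- constraint `≤ 1`.
    have hle : (f z : ℝ≥0∞) ^ (p / (p - 1)) * ∞
        ≤ ∑' x, Γ.greenOp f x ^ (p / (p - 1)) * (Γ.vertexWeight x : ℝ≥0∞) := by
      rw [← htop, ← ENNReal.tsum_mul_left]
      refine ENNReal.tsum_le_tsum fun x => ?_
      rw [← mul_assoc, ← ENNReal.mul_rpow_of_nonneg _ _ hq0.le]
      gcongr
      exact Γ.mul_tsum_stepTransition_le_greenOp (hμ z) f x
    have hpos : (f z : ℝ≥0∞) ^ (p / (p - 1)) ≠ 0 := by
      simp [ENNReal.rpow_eq_zero_iff, hz]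
    rw [ENNReal.mul_top hpos, top_le_iff] at hle
    rw [WeightedGraph.lqNorm, hle, ENNReal.top_rpow_of_pos (by positivity)] at hf
    exact absurd hf (by simp)
  simp [hfz, hp0]
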